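/- In the $k$-party one-way communication model the edges of a graph $G=(V,E)$ with $|V|=n$ are distributed among $k$ computationally unbounded parties $1,\dots,k$ with private randomness: party $i$ holds a graph $G_i=(V,E_i)$, where $E=\bigcup_{i=1}^k E_i$, and all parties know $V$. Starting from the first party, each party $i<k$ in turn sends to party $i+1$ a single message, a bit string that depends on $G_i$, on the message received from party $i-1$ (if $i>1$) and on the private random bits of party $i$. The last party then outputs a set of vertices depending on $G_k$, on the last message and on its private random bits. A minimum vertex cover (MVC) protocol must always output a vertex cover of $G$. It has expected approximation ratio (at most) $r$ if on every input the expected size of its output is at most $r$ times the size of a minimum vertex cover of $G$. Message length is measured in the worst case. **Theorem.** (a) For every $k\ge 2$ and every $\varepsilon>0$ there is a constant $C=C(k,\varepsilon)$ such that for every $n$ there is a randomized MVC protocol for $n$-vertex graphs in the $k$-party one-way communication model, in which each message has at most $Cn$ bits, with expected approximation ratio at most $2-2^{-k+1}+\varepsilon$. (b) For $k=2$ this ratio is tight up to $\varepsilon$ for protocols with $O(n)$ communication: for every $\varepsilon>0$ and every constant $C$ there is an $n_0$ such that for every $n\ge n_0$, no randomized two-party one-way MVC protocol for $n$-vertex graphs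 in which the message has at most $Cn$ bits has expected approximation ratio at most $\frac32-\varepsilon$. -/

import Mathlib

noncomputable section

/-- The size of a minimum vertex cover of a graph on a finite vertex set. -/
def mvcSize {V : Type*} (G : SimpleGraph V) : ℕ :=
  G.vertexCoverNum.toNat

/-- A randomized `k`-party one-way protocol (private randomness, computationally unbounded
parties) whose inputs are graphs on the common vertex set `V` and whose output is a set of
vertices. The parties are `0, …, k - 1`. Party `i`, for `i < k - 1`, sees its own graph and the
bit string sent by the preceding party (the empty string if `i = 0`) and sends a random bit string
to party `i + 1`; the last party sees its own graph and the last message and outputs a random set of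
vertices. As each party acts once, and private coins are independent, the behaviour of a party is a
function from what it sees to probability distributions. -/
structure OneWayProtocol (V : Type*) (k : ℕ) where
  /-- there is at least one party -/
  pos : 0 < k
  /-- the distribution of the message sent by a party other than the last one -/
  send : Fin (k - 1) → SimpleGraph V → List Bool → PMF (List Bool)
  /-- the distribution of the output of the last party -/
  output : SimpleGraph V → List Bool → PMF (Finset V)

namespace OneWayProtocol

variable {V : Type*} {k : ℕ}

/-- The distribution of the message that party `i` receives when the parties hold the graphs
`E 0, …, E (k - 1)`. -/
def received (P : OneWayProtocol V k) (E : Fin k → SimpleGraph V) :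
    (i : ℕ) → i < k → PMF (List Bool)
  | 0, _ => PMF.pure []
  | i + 1, h => (P.received E i (Nat.lt_of_succ_lt h)).bind fun M =>
      P.send ⟨i, Nat.lt_sub_of_add_lt h⟩ (E ⟨i, Nat.lt_of_succ_lt h⟩) M

/-- The distribution of the output of the protocol when the parties hold the graphs
`E 0, …, E (k - 1)`. -/
def outputDist (P : OneWayProtocol V k) (E : Fin k → SimpleGraph V) : PMF (Finset V) :=
  (P.received E (k - 1) (Nat.sub_one_lt_of_lt P.pos)).bind fun M =>
    P.output (E ⟨k - 1, Nat.sub_one_lt_of_lt P.pos⟩) M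

/-- On every input, every possible output is a vertex cover of the union of the parties' graphs. -/
def IsValid (P : OneWayProtocol V k) : Prop :=
  ∀ E : Fin k → SimpleGraph V, ∀ S ∈ (P.outputDist E).support,
    (⨆ i, E i).IsVertexCover (S : Set V)

/-- Worst-case communication: on every input, every message that is ever sent has at most
`B` bits. -/
def MessagesAtMost (P : OneWayProtocol V k) (B : ℕ) : Prop :=
  ∀ E : Fin k → SimpleGraph V, ∀ (i : ℕ) (hi : i < k), ∀ M ∈ (P.received E i hi).support,
    M.length ≤ B

/-- The expected size of the output. -/
def expectedSize [Fintype V] (P : OneWayProtocol V k) (E : Fin k → SimpleGraph V) : ℝ :=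
  ∑ S : Finset V, (P.outputDist E S).toReal * (S.card : ℝ)

/-- The protocol is a minimum vertex cover protocol of expected approximation ratio at most `r`:
it always outputs a vertex cover of the union of the parties' graphs, and on every input the
expected size of the output is at most `r` times the minimum. -/
def HasApproxRatio [Fintype V] (P : OneWayProtocol V k) (r : ℝ) : Prop :=
  P.IsValid ∧ ∀ E : Fin k → SimpleGraph V, P.expectedSize E ≤ r * (mvcSize (⨆ i, E i) : ℝ)

end OneWayProtocol

end

noncomputable section
open scoped ENNReal

/-! Upper bound. Every party adds to the set it received a random cover of its still uncovered
edges. Let `T` be an optimal cover of the whole graph and `S` the current set. A vertex of `S \ T`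
is wasted; a vertex of `T \ S` is given a price `c < 1`, standing for the waste that later messages
may cause in replacing it. The key fact (`exists_mixed_cover`) is that every graph has one
distribution on covers `S` with `E[|S \ T| + c |T \ S|] ≤ (1 + c)/2 · |T|` for all covers `T`
simultaneously. By minimax it suffices to beat a known distribution of `T`
(`exists_cover_averaged_le`). Iterating `c ↦ (1 + c)/2` from `0` gives the prices `slack j = 1 -
2⁻ʲ`, for which the expected potential never increases. The last party completes `S` with at most
`|T \ S|` vertices, so the total is at most `|T| + |S \ T|`.

Lower bound. The first party holds a sparse set `F` of edges of directed hypercubes; the second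
attaches pendants that single out a direction `j`. The pendants force one vertex per point, and
these vertices can be chosen to cover every edge outside direction `j`, so only the direction-`j`
edges of `F` cost extra. A second party knowing only the message must cover all direction-`j` edges
compatible with it. Averaged over `j`, ratio `3/2 - ε` makes the compatible edges miss a constant
fraction of the cubes. A set of such density contains few sparse `F`, so the number of messages is
exponential in `|F|`; in high dimension, `|F|` exceeds any given multiple of `n`. -/

/-! ### Averaging over finite sets of thresholds -/

open MeasureTheory in
/-- A uniformly random threshold does at least as well as its average. -/
lemma exists_threshold_sum_le {ι : Type*} [Fintype ι] (F A B : ι → ℝ)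
    (h0 : ∀ i, 0 ≤ F i) (h1 : ∀ i, F i ≤ 1) :
    ∃ u : ℝ, 0 ≤ u ∧ u < 1 ∧
      ∑ i, (if u < F i then A i else B i) ≤ ∑ i, (F i * A i + (1 - F i) * B i) := by
  have key : ∀ i, (fun u : ℝ => if u < F i then A i else B i) =
      fun u => (Set.Iio (F i)).indicator (fun _ => A i - B i) u + B i := by
    intro i
    funext u
    by_cases h : u < F i <;> simp [h]
  have hint1 : ∀ i, IntegrableOn ((Set.Iio (F i)).indicator fun _ => A i - B i)
      (Set.Ico (0 : ℝ) 1) := fun i =>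
    (integrableOn_const (by simp)).indicator measurableSet_Iio
  have hint : ∀ i, IntegrableOn (fun u : ℝ => if u < F i then A i else B i)
      (Set.Ico (0 : ℝ) 1) := by
    intro i
    rw [key]
    exact (hint1 i).add (integrableOn_const (by simp))
  have hval : ∀ i, ∫ u in Set.Ico (0 : ℝ) 1, (if u < F i then A i else B i) =
      F i * A i + (1 - F i) * B i := by
    intro i
    have hset : Set.Ico (0 : ℝ) 1 ∩ Set.Iio (F i) = Set.Ico 0 (F i) := by
      ext u
      have := h1 i
      simp only [Set.mem_inter_iff, Set.mem_Ico, Set.mem_Iio]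
      constructor
      · rintro ⟨⟨a, b⟩, c⟩; exact ⟨a, c⟩
      · rintro ⟨a, c⟩; exact ⟨⟨a, c.trans_le this⟩, c⟩
    rw [key, integral_add (hint1 i) (integrableOn_const (by simp)),
      setIntegral_indicator measurableSet_Iio, hset]
    simp [h0 i]
    ring
  obtain ⟨u, hu, hle⟩ := exists_le_setAverage (μ := volume) (s := Set.Ico (0 : ℝ) 1)
    (f := fun u => ∑ i, if u < F i then A i else B i) (by simp) (by simp)
    (integrable_finsetSum _ fun i _ => hint i)
  refine ⟨u, hu.1, hu.2, hle.trans (le_of_eq ?_)⟩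
  rw [setAverage_eq, integral_finsetSum _ fun i _ => hint i]
  simp [hval]

/-! ### Von Neumann's minimax theorem for matrix games -/

/-- The bilinear payoff has a saddle point by Sion's theorem; comparing it with pure strategies on
both sides gives the claim. -/
lemma exists_mixed_of_forall_exists_le {ι κ : Type*} [Fintype ι] [Fintype κ] [Nonempty κ]
    (A : ι → κ → ℝ)
    (h : ∀ y ∈ stdSimplex ℝ κ, ∃ i, ∑ j, y j * A i j ≤ 0) :
    ∃ x ∈ stdSimplex ℝ ι, ∀ j, ∑ i, x i * A i j ≤ 0 := by
  classical
  let L : (ι → ℝ) →ₗ[ℝ] (κ → ℝ) →ₗ[ℝ] ℝ :=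
    LinearMap.mk₂ ℝ (fun x y => ∑ i, ∑ j, x i * (y j * A i j))
      (by intros; simp [add_mul, Finset.sum_add_distrib])
      (by intros; simp [mul_assoc, Finset.mul_sum])
      (by intros; simp [add_mul, mul_add, Finset.sum_add_distrib])
      (by intros; simp [mul_assoc, mul_left_comm, Finset.mul_sum])
  have hL : ∀ x y, L x y = ∑ i, ∑ j, x i * (y j * A i j) := fun _ _ => rfl
  have hκ : (stdSimplex ℝ κ).Nonempty := ⟨_, single_mem_stdSimplex ℝ (Classical.arbitrary κ)⟩
  obtain ⟨i₀, -⟩ := h _ hκ.some_mem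
  have hι : (stdSimplex ℝ ι).Nonempty := ⟨_, single_mem_stdSimplex ℝ i₀⟩
  obtain ⟨a, ha, b, hb, hab⟩ := Sion.exists_isSaddlePointOn (X := stdSimplex ℝ ι)
    (Y := stdSimplex ℝ κ) (f := fun x y => L x y) hι (convex_stdSimplex ℝ ι)
    (isCompact_stdSimplex ℝ ι)
    (fun y _ => ((by simp only [hL]; fun_prop :
      Continuous fun x => L x y).lowerSemicontinuous).lowerSemicontinuousOn _)
    (fun y _ => ((L.flip y).convexOn (convex_stdSimplex ℝ ι)).quasiconvexOn)
    (convex_stdSimplex ℝ κ) hκ (isCompact_stdSimplex ℝ κ)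
    (fun x _ => ((by simp only [hL]; fun_prop :
      Continuous fun y => L x y).upperSemicontinuous).upperSemicontinuousOn _)
    (fun x _ => ((L x).concaveOn (convex_stdSimplex ℝ κ)).quasiconcaveOn)
  obtain ⟨i, hi⟩ := h b hb
  refine ⟨a, ha, fun j => ?_⟩
  have := hab _ (single_mem_stdSimplex ℝ i) _ (single_mem_stdSimplex ℝ j)
  simp only [hL] at this
  refine le_trans (le_of_eq ?_) (this.trans (le_trans (le_of_eq ?_) hi))
  · refine Finset.sum_congr rfl fun i' _ => ?_
    rw [Finset.sum_eq_single j] <;> simp +contextual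
  · rw [Finset.sum_eq_single i] <;> simp +contextual

/-! ### A random vertex cover that is close to every vertex cover -/

/-- The probability with which a vertex covered with probability `1/2 ± (1/2 - y)` follows the
random cover. -/
def followProb (c y : ℝ) : ℝ := (1 - c) / (2 * (1 - (1 + c) * y))

section followProb

variable {c y : ℝ}

lemma followProb_denom_pos (hc0 : 0 ≤ c) (hc1 : c < 1) (hy : y ≤ 1 / 2) :
    0 < 1 - (1 + c) * y := by nlinarith

lemma followProb_nonneg (hc0 : 0 ≤ c) (hc1 : c < 1) (hy : y ≤ 1 / 2) : 0 ≤ followProb c y :=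
  div_nonneg (by linarith) (by linarith [followProb_denom_pos hc0 hc1 hy])

lemma followProb_le_one (hc0 : 0 ≤ c) (hc1 : c < 1) (hy : y ≤ 1 / 2) : followProb c y ≤ 1 := by
  have := followProb_denom_pos hc0 hc1 hy
  rw [followProb, div_le_one (by linarith)]
  nlinarith

lemma followProb_half (hc1 : c < 1) : followProb c (1 / 2) = 1 := by
  rw [followProb, div_eq_one_iff_eq] <;> [ring; linarith]

lemma followProb_mono (hc0 : 0 ≤ c) (hc1 : c < 1) {z : ℝ} (hyz : y ≤ z) (hz : z ≤ 1 / 2) :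
    followProb c y ≤ followProb c z := by
  have := followProb_denom_pos hc0 hc1 hz
  apply div_le_div_of_nonneg_left (by linarith) (by linarith)
  nlinarith

/-- This equation dictates the formula for `followProb`: on vertices with `x v ≤ 1/2` the target
cost is met exactly. -/
lemma followProb_cost_low (hc0 : 0 ≤ c) (hc1 : c < 1) (hy : y ≤ 1 / 2) :
    followProb c y * (y * (1 - y) * (1 + c)) + (1 - followProb c y) * (c * y) =
      (1 + c) / 2 * y := by
  have := followProb_denom_pos hc0 hc1 hy
  rw [followProb]
  field_simp
  ring

lemma followProb_cost_high (hc0 : 0 ≤ c) (hc1 : c < 1) (hy : y ≤ 1 / 2) :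
    followProb c y * (y * (1 - y) * (1 + c)) + (1 - followProb c y) * y ≤
      (1 + c) / 2 * (1 - y) := by
  have hD := followProb_denom_pos hc0 hc1 hy
  have h2 : followProb c y * (2 * (1 - (1 + c) * y)) = 1 - c := by
    rw [followProb]; field_simp
  -- Once the denominator is cleared, the two sides differ by exactly this quantity.
  have key : 0 ≤ (1 + c) * (1 - 2 * y) ^ 2 := by positivity
  refine le_of_mul_le_mul_right ?_ (show 0 < 2 * (1 - (1 + c) * y) by linarith)
  have e1 : (followProb c y * (y * (1 - y) * (1 + c)) + (1 - followProb c y) * y) *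
      (2 * (1 - (1 + c) * y)) =
      (followProb c y * (2 * (1 - (1 + c) * y))) * (y * (1 - y) * (1 + c) - y) +
        y * (2 * (1 - (1 + c) * y)) := by ring
  rw [e1, h2]
  nlinarith

end followProb

variable {V : Type*}

/-- The weighted distance between a vertex cover `S` and a vertex cover `T`, minus its target. -/
def coverExcess [DecidableEq V] (c : ℝ) (S T : Finset V) : ℝ :=
  ((S \ T).card : ℝ) + c * ((T \ S).card : ℝ) - (1 + c) / 2 * (T.card : ℝ)

lemma coverExcess_eq_sum [Fintype V] [DecidableEq V] (c : ℝ) (S T : Finset V) :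
    coverExcess c S T = ∑ v, ((if v ∈ S then 1 - (if v ∈ T then (1 : ℝ) else 0) else
      c * (if v ∈ T then (1 : ℝ) else 0)) - (1 + c) / 2 * (if v ∈ T then (1 : ℝ) else 0)) := by
  have h1 : ((S \ T).card : ℝ) = ∑ v, if v ∈ S ∧ v ∉ T then (1 : ℝ) else 0 := by
    rw [Finset.sum_boole]; congr 2; ext; simp
  have h2 : ((T \ S).card : ℝ) = ∑ v, if v ∈ T ∧ v ∉ S then (1 : ℝ) else 0 := by
    rw [Finset.sum_boole]; congr 2; ext; simp
  have h3 : (T.card : ℝ) = ∑ v, if v ∈ T then (1 : ℝ) else 0 := by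
    rw [Finset.sum_boole]; congr 2; ext; simp
  rw [coverExcess, h1, h2, h3, Finset.mul_sum, Finset.mul_sum, ← Finset.sum_add_distrib,
    ← Finset.sum_sub_distrib]
  refine Finset.sum_congr rfl fun v _ => ?_
  by_cases hS : v ∈ S <;> by_cases hT : v ∈ T <;> simp [hS, hT]

-- The marginals `x v` of `μ` form a fractional vertex cover. A hybrid of two roundings is used: for
-- a common threshold `u`, the vertices with `u < F v` copy a sample `T'` of `μ`, the others are
-- rounded at `1/2`. The hybrid beats the target on average over `u` and `T'`.
open Classical in
lemma exists_cover_averaged_le [Fintype V] (G : SimpleGraph V) {c : ℝ} (hc0 : 0 ≤ c) (hc1 : c < 1)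
    (μ : {T : Finset V // G.IsVertexCover T} → ℝ) (hμ : μ ∈ stdSimplex ℝ _) :
    ∃ S : {T : Finset V // G.IsVertexCover T}, ∑ T, μ T * coverExcess c S.1 T.1 ≤ 0 := by
  obtain ⟨hμ0, hμ1⟩ := hμ
  set x : V → ℝ := fun v => ∑ T, μ T * (if v ∈ T.1 then (1 : ℝ) else 0) with hx
  have hx0 : ∀ v, 0 ≤ x v := fun v => Finset.sum_nonneg fun T _ =>
    mul_nonneg (hμ0 T) (by split_ifs <;> norm_num)
  have hxadd : ∀ v w, G.Adj v w → 1 ≤ x v + x w := by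
    intro v w hvw
    refine hμ1.symm.le.trans ?_
    simp only [hx, ← Finset.sum_add_distrib]
    refine Finset.sum_le_sum fun T _ => ?_
    rw [← mul_add]
    refine le_mul_of_one_le_right (hμ0 T) ?_
    rcases T.2 hvw with h | h <;> rw [Finset.mem_coe] at h <;> simp only [h, if_true] <;>
      split_ifs <;> norm_num
  have hx1 : ∀ v, x v ≤ 1 := by
    intro v
    refine le_trans ?_ hμ1.le
    refine Finset.sum_le_sum fun T _ => mul_le_of_le_one_right (hμ0 T) (by split_ifs <;> norm_num)
  have hsum : ∀ S : Finset V, ∑ T, μ T * coverExcess c S T.1 =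
      ∑ v, ((if v ∈ S then 1 - x v else c * x v) - (1 + c) / 2 * x v) := by
    intro S
    simp_rw [coverExcess_eq_sum, Finset.mul_sum]
    rw [Finset.sum_comm]
    refine Finset.sum_congr rfl fun v _ => ?_
    by_cases hS : v ∈ S
    · simp only [hS, if_true, hx, mul_sub, Finset.sum_sub_distrib, mul_one, hμ1, Finset.mul_sum]
      congr 1
      exact Finset.sum_congr rfl fun T _ => by ring
    · simp only [hS, if_false, hx, mul_sub, Finset.sum_sub_distrib, Finset.mul_sum]
      congr 1 <;> exact Finset.sum_congr rfl fun T _ => by ring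
  set y : V → ℝ := fun v => min (x v) (1 - x v) with hy
  have hyhalf : ∀ v, y v ≤ 1 / 2 := fun v => by
    rcases le_total (x v) (1 / 2) with h | h
    · exact (min_le_left _ _).trans h
    · exact (min_le_right _ _).trans (by linarith)
  set F : V → ℝ := fun v => followProb c (y v) with hF
  set A : V → ℝ := fun v => y v * (1 - y v) * (1 + c) with hA
  set B : V → ℝ := fun v => if 1 / 2 < x v then 1 - x v else c * x v with hB
  have hcost : ∀ v, F v * A v + (1 - F v) * B v ≤ (1 + c) / 2 * x v := by
    intro v
    by_cases h : 1 / 2 < x v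
    · have hyv : y v = 1 - x v := min_eq_right (by linarith)
      have := followProb_cost_high hc0 hc1 (hyhalf v)
      simp only [hF, hA, hB, if_pos h]
      rw [hyv] at this ⊢
      linarith
    · have hyv : y v = x v := min_eq_left (by linarith)
      have := followProb_cost_low hc0 hc1 (hyhalf v)
      simp only [hF, hA, hB, if_neg h]
      rw [hyv] at this ⊢
      linarith
  obtain ⟨u, hu0, hu1, hu⟩ := exists_threshold_sum_le F A B
    (fun v => followProb_nonneg hc0 hc1 (hyhalf v)) (fun v => followProb_le_one hc0 hc1 (hyhalf v))
  have hcover : ∀ T' : {T : Finset V // G.IsVertexCover T}, G.IsVertexCover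
      (Finset.univ.filter fun v => if u < F v then v ∈ T'.1 else 1 / 2 < x v : Finset V) := by
    -- If `v` is rounded down, a neighbour `w` has `x w ≥ 1 - x v`, hence lies at least as far from
    -- `1/2`; by monotonicity it is rounded too, and upwards. Ties `x v = 1/2` never occur since
    -- there `F v = 1 > u`.
    have aux : ∀ T' : {T : Finset V // G.IsVertexCover T}, ∀ v w, G.Adj v w → ¬ u < F v →
        (1 / 2 < x v) ∨ (if u < F w then w ∈ T'.1 else 1 / 2 < x w) := by
      intro T' v w hvw hv
      rcases lt_trichotomy (x v) (1 / 2) with h | h | h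
      · right
        have := hxadd v w hvw
        have hyv : y v = x v := min_eq_left (by linarith)
        have hyw : y w = 1 - x w := min_eq_right (by linarith)
        have hle : F w ≤ F v := followProb_mono hc0 hc1 (by rw [hyv, hyw]; linarith) (hyhalf v)
        rw [if_neg (fun h' => hv (h'.trans_le hle))]
        linarith
      · exfalso
        have hyv : y v = 1 / 2 := by rw [hy]; simp only [h]; norm_num
        apply hv
        rw [hF]
        simp only [hyv, followProb_half hc1]
        exact hu1
      · exact Or.inl h
    intro T' v w hvw
    simp only [Finset.coe_filter, Finset.mem_univ, true_and, Set.mem_ofPred_eq]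
    by_cases hv : u < F v
    · by_cases hw : u < F w
      · rw [if_pos hv, if_pos hw]
        exact T'.2 hvw
      · rw [if_neg hw]
        exact (aux T' w v hvw.symm hw).symm
    · rw [if_neg hv]
      exact aux T' v w hvw hv
  by_contra! hcon
  have hpos : 0 < ∑ T', μ T' * ∑ T, μ T * coverExcess c
      (Finset.univ.filter fun v => if u < F v then v ∈ T'.1 else 1 / 2 < x v) T.1 := by
    obtain ⟨T₀, hT₀⟩ : ∃ T₀, 0 < μ T₀ := by
      by_contra! h
      have : ∑ T, μ T ≤ 0 := Finset.sum_nonpos fun T _ => h T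
      linarith
    refine Finset.sum_pos' (fun T' _ => mul_nonneg (hμ0 T') (hcon ⟨_, hcover T'⟩).le)
      ⟨T₀, Finset.mem_univ _, mul_pos hT₀ (hcon ⟨_, hcover T₀⟩)⟩
  simp_rw [hsum, Finset.mul_sum] at hpos
  rw [Finset.sum_comm] at hpos
  have heq : ∀ v, ∑ T' : {T : Finset V // G.IsVertexCover T}, μ T' *
      ((if v ∈ Finset.univ.filter (fun v => if u < F v then v ∈ T'.1 else 1 / 2 < x v)
        then 1 - x v else c * x v) - (1 + c) / 2 * x v) =
      (if u < F v then A v else B v) - (1 + c) / 2 * x v := by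
    intro v
    simp only [mul_sub, Finset.sum_sub_distrib, ← Finset.sum_mul, hμ1, one_mul]
    congr 1
    by_cases hv : u < F v
    · simp only [hv, Finset.mem_filter, Finset.mem_univ, true_and, if_true]
      have : ∀ T' : {T : Finset V // G.IsVertexCover T},
          μ T' * (if v ∈ T'.1 then 1 - x v else c * x v) =
          μ T' * (if v ∈ T'.1 then (1 : ℝ) else 0) * (1 - x v - c * x v) + μ T' * (c * x v) := by
        intro T'; split_ifs <;> ring
      simp_rw [this, Finset.sum_add_distrib, ← Finset.sum_mul, hμ1]
      have hxv : ∑ T', μ T' * (if v ∈ T'.1 then (1 : ℝ) else 0) = x v := rfl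
      rw [hxv]
      -- `T'` and `T` are independent, so copying costs `(1 + c) x (1 - x)`, which is symmetric
      -- under `x ↦ 1 - x`.
      have : y v * (1 - y v) = x v * (1 - x v) := by
        rcases min_choice (x v) (1 - x v) with h | h <;> simp only [hy, h]
        ring
      simp only [hA, this]
      ring
    · simp only [hv, Finset.mem_filter, Finset.mem_univ, true_and, if_false]
      rw [← Finset.sum_mul, hμ1, one_mul]
  simp_rw [heq] at hpos
  rw [Finset.sum_sub_distrib] at hpos
  have := Finset.sum_le_sum fun v (_ : v ∈ Finset.univ) => hcost v
  linarith

/-- For every graph there is a random vertex cover that is, in expectation, within weighted distance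
`(1 + c) / 2 * |T|` of every vertex cover `T`. -/
lemma exists_mixed_cover [Fintype V] [DecidableEq V] (G : SimpleGraph V) {c : ℝ} (hc0 : 0 ≤ c)
    (hc1 : c < 1) :
    ∃ w : Finset V → ℝ, (∀ S, 0 ≤ w S) ∧ ∑ S, w S = 1 ∧ (∀ S, w S ≠ 0 → G.IsVertexCover S) ∧
      ∀ T : Finset V, G.IsVertexCover T → ∑ S, w S * coverExcess c S T ≤ 0 := by
  classical
  have : Nonempty {T : Finset V // G.IsVertexCover T} := ⟨⟨Finset.univ, by simp⟩⟩
  obtain ⟨x, ⟨hx0, hx1⟩, hx⟩ := exists_mixed_of_forall_exists_le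
    (fun S T : {T : Finset V // G.IsVertexCover T} => coverExcess c S.1 T.1)
    (fun μ hμ => by convert exists_cover_averaged_le G hc0 hc1 μ hμ)
  have hsum : ∀ f : Finset V → ℝ,
      ∑ S : Finset V, (if h : G.IsVertexCover S then x ⟨S, h⟩ else 0) * f S =
        ∑ S, x S * f S.1 := by
    intro f
    rw [← Finset.sum_filter_of_ne (p := fun S : Finset V => G.IsVertexCover S)
      (by intro S _ h; by_contra h'; simp [h'] at h),
      Finset.sum_subtype (p := fun S : Finset V => G.IsVertexCover S) _ (by simp)]
    exact Finset.sum_congr rfl fun S _ => by rw [dif_pos S.2]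
  refine ⟨fun S => if h : G.IsVertexCover S then x ⟨S, h⟩ else 0, ?_, ?_, ?_, ?_⟩
  · intro S
    dsimp only
    split_ifs
    exacts [hx0 _, le_rfl]
  · simpa [hx1] using hsum 1
  · intro S hS
    by_contra h
    simp [h] at hS
  · intro T hT
    rw [hsum]
    exact hx ⟨T, hT⟩

/-! ### Expectations over discrete distributions -/

namespace PMF

variable {α β : Type*}

/-- The expectation of a nonnegative function under a discrete distribution. -/
def expect (p : PMF α) (f : α → ℝ≥0∞) : ℝ≥0∞ := ∑' a, p a * f a

lemma expect_bind (p : PMF α) (q : α → PMF β) (f : β → ℝ≥0∞) :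
    (p.bind q).expect f = p.expect fun a => (q a).expect f := by
  simp only [expect, bind_apply, ← ENNReal.tsum_mul_right, ← ENNReal.tsum_mul_left]
  rw [ENNReal.tsum_comm]
  simp only [mul_assoc]

lemma expect_pure (a : α) (f : α → ℝ≥0∞) : (PMF.pure a).expect f = f a := by
  classical
  rw [expect, tsum_eq_single a] <;> simp +contextual [pure_apply]

lemma expect_mono {p : PMF α} {f g : α → ℝ≥0∞} (h : ∀ a ∈ p.support, f a ≤ g a) :
    p.expect f ≤ p.expect g := by
  refine ENNReal.tsum_le_tsum fun a => ?_
  by_cases ha : p a = 0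
  · simp [ha]
  · exact mul_le_mul_right (h a ha) _

lemma expect_const (p : PMF α) (c : ℝ≥0∞) : (p.expect fun _ => c) = c := by
  rw [expect, ENNReal.tsum_mul_right, p.tsum_coe, one_mul]

lemma expect_add (p : PMF α) (f g : α → ℝ≥0∞) :
    (p.expect fun a => f a + g a) = p.expect f + p.expect g := by
  simp only [expect, mul_add, ENNReal.tsum_add]

lemma expect_sum {ι : Type*} (s : Finset ι) (p : PMF α) (f : ι → α → ℝ≥0∞) :
    (p.expect fun a => ∑ i ∈ s, f i a) = ∑ i ∈ s, p.expect (f i) := by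
  simp only [expect, Finset.mul_sum]
  exact Summable.tsum_finsetSum fun _ _ => ENNReal.summable

lemma le_expect {p : PMF α} {f : α → ℝ≥0∞} {c : ℝ≥0∞} (h : ∀ a ∈ p.support, c ≤ f a) :
    c ≤ p.expect f :=
  (p.expect_const c).symm.le.trans (expect_mono h)

end PMF

/-! ### Minimum vertex covers -/

section VertexCover

variable {V : Type*}

lemma exists_isVertexCover_card_eq_mvcSize [Fintype V] (G : SimpleGraph V) :
    ∃ T : Finset V, G.IsVertexCover T ∧ T.card = mvcSize G := by
  obtain ⟨s, hs, hc⟩ := G.vertexCoverNum_exists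
  have hfin := s.toFinite
  refine ⟨hfin.toFinset, by simpa using hc, ?_⟩
  rw [mvcSize, ← hs, hfin.encard_eq_coe_toFinset_card]
  rfl

lemma mvcSize_le_card {G : SimpleGraph V} {T : Finset V} (hT : G.IsVertexCover T) :
    mvcSize G ≤ T.card := by
  have h := hT.vertexCoverNum_le
  rw [Set.encard_coe_eq_coe_finsetCard] at h
  exact ENat.toNat_le_of_le_natCast h

end VertexCover

namespace OneWayProtocol

variable {V : Type*} [Fintype V] {k : ℕ}

lemma ofReal_expectedSize (P : OneWayProtocol V k) (E : Fin k → SimpleGraph V) :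
    ENNReal.ofReal (P.expectedSize E) = (P.outputDist E).expect fun S => (S.card : ℝ≥0∞) := by
  rw [expectedSize, ENNReal.ofReal_sum_of_nonneg (fun S _ => by positivity), PMF.expect,
    tsum_fintype]
  refine Finset.sum_congr rfl fun S _ => ?_
  rw [ENNReal.ofReal_mul ENNReal.toReal_nonneg, ENNReal.ofReal_toReal (PMF.apply_ne_top _ _),
    ENNReal.ofReal_natCast]

lemma expectedSize_nonneg (P : OneWayProtocol V k) (E : Fin k → SimpleGraph V) :
    0 ≤ P.expectedSize E :=
  Finset.sum_nonneg fun _ _ => by positivity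

end OneWayProtocol

/-! ### The protocol -/

/-- The weighted distance of `S` from `T`. -/
def coverDist {V : Type*} [DecidableEq V] (c : ℝ) (S T : Finset V) : ℝ≥0∞ :=
  ((S \ T).card : ℝ≥0∞) + ENNReal.ofReal c * ((T \ S).card : ℝ≥0∞)

section RandomCover

variable {V : Type*} [DecidableEq V]

lemma exists_pmf_cover [Fintype V] (G : SimpleGraph V) {c : ℝ} (hc0 : 0 ≤ c) (hc1 : c < 1) :
    ∃ D : PMF (Finset V), (∀ S ∈ D.support, G.IsVertexCover S) ∧
      ∀ T : Finset V, G.IsVertexCover T →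
        (D.expect fun S => coverDist c S T) ≤ ENNReal.ofReal ((1 + c) / 2) * T.card := by
  obtain ⟨w, hw0, hw1, hwG, hwT⟩ := exists_mixed_cover G hc0 hc1
  refine ⟨PMF.ofFintype (fun S => ENNReal.ofReal (w S)) ?_, ?_, ?_⟩
  · rw [← ENNReal.ofReal_sum_of_nonneg fun S _ => hw0 S, hw1, ENNReal.ofReal_one]
  · intro S hS
    rw [PMF.support_ofFintype, Function.mem_support] at hS
    exact hwG S fun h => hS (by simp [h])
  · intro T hT
    have hterm : ∀ S, ENNReal.ofReal (w S) * coverDist c S T =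
        ENNReal.ofReal (w S * (((S \ T).card : ℝ) + c * ((T \ S).card : ℝ))) := by
      intro S
      rw [coverDist, ENNReal.ofReal_mul (hw0 S), ENNReal.ofReal_add (by positivity)
        (by positivity), ENNReal.ofReal_mul hc0, ENNReal.ofReal_natCast, ENNReal.ofReal_natCast]
    rw [PMF.expect, tsum_fintype]
    simp only [PMF.ofFintype_apply, hterm]
    rw [← ENNReal.ofReal_sum_of_nonneg fun S _ => mul_nonneg (hw0 S) (by positivity),
      ← ENNReal.ofReal_natCast, ← ENNReal.ofReal_mul (by linarith)]
    refine ENNReal.ofReal_le_ofReal ?_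
    have h := hwT T hT
    simp only [coverExcess, mul_sub, Finset.sum_sub_distrib, ← Finset.sum_mul, hw1, one_mul] at h
    linarith

/-- The edges of `G` that `S` does not cover. -/
def uncovered (G : SimpleGraph V) (S : Finset V) : SimpleGraph V where
  Adj u v := G.Adj u v ∧ u ∉ S ∧ v ∉ S
  symm := ⟨fun _ _ h => ⟨h.1.symm, h.2.2, h.2.1⟩⟩
  loopless := ⟨fun _ h => h.1.ne rfl⟩

lemma isVertexCover_union {G : SimpleGraph V} {S R : Finset V}
    (h : (uncovered G S).IsVertexCover R) : G.IsVertexCover (S ∪ R : Finset V) := by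
  intro u v huv
  simp only [Finset.coe_union, Set.mem_union, Finset.mem_coe]
  by_cases hu : u ∈ S
  · exact Or.inl (Or.inl hu)
  by_cases hv : v ∈ S
  · exact Or.inr (Or.inl hv)
  exact (h ⟨huv, hu, hv⟩).imp Or.inr Or.inr

lemma uncovered_isVertexCover_sdiff {G : SimpleGraph V} {S T : Finset V}
    (h : G.IsVertexCover T) : (uncovered G S).IsVertexCover (T \ S : Finset V) := by
  intro u v huv
  simp only [Finset.coe_sdiff, Set.mem_sdiff, Finset.mem_coe]
  exact (h huv.1).imp (fun h => ⟨h, huv.2.1⟩) fun h => ⟨h, huv.2.2⟩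

end RandomCover

/-- The weight of uncovered vertices of the optimum when `j` more messages are to be sent. -/
def slack (j : ℕ) : ℝ := 1 - (1 / 2) ^ j

lemma slack_nonneg (j : ℕ) : 0 ≤ slack j :=
  sub_nonneg.2 (pow_le_one₀ (by norm_num) (by norm_num))

lemma slack_lt_one (j : ℕ) : slack j < 1 := by
  have : (0 : ℝ) < (1 / 2) ^ j := by positivity
  rw [slack]; linarith

/-- The price recursion matches the factor `(1 + c) / 2` of `exists_pmf_cover`. -/
lemma slack_succ (j : ℕ) : slack (j + 1) = (1 + slack j) / 2 := by
  rw [slack, slack, pow_succ]; ring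

section Protocol

variable {n : ℕ}

/-- The characteristic bit string of a set of vertices. -/
def encodeSet (S : Finset (Fin n)) : List Bool := List.ofFn fun v => decide (v ∈ S)

/-- The set of vertices with a given characteristic bit string. -/
def decodeSet (n : ℕ) (M : List Bool) : Finset (Fin n) :=
  Finset.univ.filter fun v => M[v.1]? = some true

lemma decodeSet_encodeSet (S : Finset (Fin n)) : decodeSet n (encodeSet S) = S := by
  ext v
  simp [decodeSet, encodeSet]

lemma decodeSet_nil : decodeSet n [] = ∅ := by
  ext v
  simp [decodeSet]

lemma length_encodeSet (S : Finset (Fin n)) : (encodeSet S).length = n := by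
  simp [encodeSet]

/-- A random vertex cover of `G` that is close to every vertex cover. -/
def randomCover (G : SimpleGraph (Fin n)) (j : ℕ) : PMF (Finset (Fin n)) :=
  (exists_pmf_cover G (slack_nonneg j) (slack_lt_one j)).choose

lemma randomCover_support {G : SimpleGraph (Fin n)} {j : ℕ} :
    ∀ S ∈ (randomCover G j).support, G.IsVertexCover S :=
  (exists_pmf_cover G (slack_nonneg j) (slack_lt_one j)).choose_spec.1

lemma randomCover_expect {G : SimpleGraph (Fin n)} (j : ℕ) {T : Finset (Fin n)}
    (hT : G.IsVertexCover T) :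
    ((randomCover G j).expect fun S => coverDist (slack j) S T) ≤
      ENNReal.ofReal (slack (j + 1)) * T.card := by
  rw [slack_succ]
  exact (exists_pmf_cover G (slack_nonneg j) (slack_lt_one j)).choose_spec.2 T hT

/-- A minimum vertex cover. -/
def minCover (G : SimpleGraph (Fin n)) : Finset (Fin n) :=
  (exists_isVertexCover_card_eq_mvcSize G).choose

lemma minCover_isVertexCover (G : SimpleGraph (Fin n)) : G.IsVertexCover (minCover G) :=
  (exists_isVertexCover_card_eq_mvcSize G).choose_spec.1

lemma card_minCover (G : SimpleGraph (Fin n)) : (minCover G).card = mvcSize G :=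
  (exists_isVertexCover_card_eq_mvcSize G).choose_spec.2

/-- The protocol in which each party extends the set it receives by a random cover of the edges of
its graph that are not covered yet, and the last party extends it optimally. -/
def coverExtensionProtocol (n k : ℕ) (hk : 0 < k) : OneWayProtocol (Fin n) k where
  pos := hk
  -- After party `i` has spoken, `k - 2 - i` messages remain.
  send i G M := (randomCover (uncovered G (decodeSet n M)) (k - 2 - i)).bind fun S =>
    PMF.pure (encodeSet (decodeSet n M ∪ S))
  output G M := PMF.pure (decodeSet n M ∪ minCover (uncovered G (decodeSet n M)))

variable {k : ℕ} (hk : 0 < k) (E : Fin k → SimpleGraph (Fin n))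

lemma coverExtensionProtocol_received_support (i : ℕ) (hi : i < k) :
    ∀ M ∈ ((coverExtensionProtocol n k hk).received E i hi).support, M.length ≤ n ∧
      ∀ j : Fin k, j.1 < i → (E j).IsVertexCover (decodeSet n M) := by
  induction i with
  | zero => simp [OneWayProtocol.received]
  | succ i ih =>
    intro M hM
    simp only [OneWayProtocol.received, coverExtensionProtocol, PMF.mem_support_bind_iff,
      PMF.mem_support_pure_iff] at hM
    obtain ⟨M', hM', S, hS, rfl⟩ := hM
    obtain ⟨-, h⟩ := ih _ M' hM'
    refine ⟨(length_encodeSet _).le, fun j hj => ?_⟩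
    rw [decodeSet_encodeSet]
    rcases Nat.lt_succ_iff_lt_or_eq.1 hj with hj | hj
    · exact (h j hj).subset (by simp)
    · have : j = ⟨i, Nat.lt_of_succ_lt hi⟩ := Fin.ext hj
      rw [this]
      exact isVertexCover_union (randomCover_support S hS)

lemma coverExtensionProtocol_isValid : (coverExtensionProtocol n k hk).IsValid := by
  intro E S hS
  simp only [OneWayProtocol.outputDist, PMF.mem_support_bind_iff] at hS
  obtain ⟨M, hM, hS⟩ := hS
  simp only [coverExtensionProtocol, PMF.mem_support_pure_iff] at hS
  subst hS
  obtain ⟨-, h⟩ := coverExtensionProtocol_received_support hk E _ _ M hM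
  intro u v huv
  obtain ⟨j, hj⟩ := SimpleGraph.iSup_adj.1 huv
  by_cases hjk : j.1 < k - 1
  · exact ((h j hjk).subset (by simp)) hj
  · have : j = ⟨k - 1, Nat.sub_one_lt_of_lt hk⟩ := Fin.ext (by simp; omega)
    rw [this] at hj
    exact isVertexCover_union (minCover_isVertexCover _) hj

lemma coverDist_union_le {c : ℝ} (S R T : Finset (Fin n)) :
    coverDist c (S ∪ R) T ≤ ((S \ T).card : ℝ≥0∞) + coverDist c R (T \ S) := by
  rw [coverDist, coverDist, ← add_assoc]
  refine add_le_add ?_ (mul_le_mul_right (Nat.cast_le.2 (Finset.card_le_card ?_)) _)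
  · rw [← Nat.cast_add, Nat.cast_le]
    refine (Finset.card_le_card ?_).trans (Finset.card_union_le _ _)
    intro v
    simp only [Finset.mem_sdiff, Finset.mem_union]
    tauto
  · intro v
    simp only [Finset.mem_sdiff, Finset.mem_union]
    tauto

-- Potential argument: `T \ S` covers what `S` leaves uncovered, so one random cover turns the price
-- `slack (j + 1)` of each vertex of `T \ S` into waste plus price `slack j` without raising the
-- expected total.
variable {E} in
lemma coverExtensionProtocol_received_expect {T : Finset (Fin n)} (hT : (⨆ i, E i).IsVertexCover T)
    (i : ℕ) (hi : i < k) :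
    (((coverExtensionProtocol n k hk).received E i hi).expect fun M =>
      coverDist (slack (k - 1 - i)) (decodeSet n M) T) ≤
        ENNReal.ofReal (slack (k - 1)) * T.card := by
  induction i with
  | zero =>
    rw [OneWayProtocol.received, PMF.expect_pure, decodeSet_nil]
    simp [coverDist]
  | succ i ih =>
    rw [OneWayProtocol.received, PMF.expect_bind]
    refine le_trans (PMF.expect_mono fun M _ => ?_) (ih (Nat.lt_of_succ_lt hi))
    have hT' : (uncovered (E ⟨i, Nat.lt_of_succ_lt hi⟩) (decodeSet n M)).IsVertexCover
        (T \ decodeSet n M : Finset _) :=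
      uncovered_isVertexCover_sdiff (hT.mono (le_iSup E _))
    have e1 : k - 1 - (i + 1) = k - 2 - i := by omega
    have e2 : k - 1 - i = k - 2 - i + 1 := by omega
    simp only [coverExtensionProtocol]
    rw [PMF.expect_bind]
    simp only [PMF.expect_pure, decodeSet_encodeSet, e1]
    refine (PMF.expect_mono fun S _ => coverDist_union_le _ S T).trans ?_
    rw [PMF.expect_add, PMF.expect_const, e2]
    exact add_le_add le_rfl (randomCover_expect _ hT')

lemma coverExtensionProtocol_hasApproxRatio :
    (coverExtensionProtocol n k hk).HasApproxRatio (1 + slack (k - 1)) := by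
  refine ⟨coverExtensionProtocol_isValid hk, fun E => ?_⟩
  have hs := slack_nonneg (k - 1)
  rw [← ENNReal.ofReal_le_ofReal_iff (by positivity), OneWayProtocol.ofReal_expectedSize,
    ENNReal.ofReal_mul (by positivity), ENNReal.ofReal_add zero_le_one hs, ENNReal.ofReal_one,
    ENNReal.ofReal_natCast]
  obtain ⟨T, hT, hcard⟩ := exists_isVertexCover_card_eq_mvcSize (⨆ i, E i)
  rw [← hcard, OneWayProtocol.outputDist, PMF.expect_bind, add_mul, one_mul]
  have h := coverExtensionProtocol_received_expect hk hT (k - 1) (Nat.sub_one_lt_of_lt hk)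
  refine le_trans ?_ (add_le_add le_rfl h)
  rw [← PMF.expect_const ((coverExtensionProtocol n k hk).received E (k - 1) (Nat.sub_one_lt_of_lt hk))
    (T.card : ℝ≥0∞), ← PMF.expect_add]
  refine PMF.expect_mono fun M _ => ?_
  simp only [coverExtensionProtocol, PMF.expect_pure, coverDist, Nat.sub_self]
  refine le_trans ?_ (add_le_add le_rfl le_self_add)
  -- The final price is `slack 0 = 0`; what remains is `|S| + |T \ S| = |T| + |S \ T|`.
  rw [← Nat.cast_add, Nat.cast_le]
  set S := decodeSet n M
  have h1 := Finset.card_union_le S (minCover (uncovered (E ⟨k - 1, Nat.sub_one_lt_of_lt hk⟩) S))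
  have h2 := mvcSize_le_card (uncovered_isVertexCover_sdiff (S := S)
    (hT.mono (le_iSup E ⟨k - 1, Nat.sub_one_lt_of_lt hk⟩)))
  rw [card_minCover] at h1
  have h3 := Finset.card_sdiff_add_card S T
  have h4 := Finset.card_sdiff_add_card T S
  rw [Finset.union_comm] at h4
  omega

theorem exists_protocol_ratio (n : ℕ) {k : ℕ} (hk : 0 < k) :
    ∃ P : OneWayProtocol (Fin n) k,
      P.MessagesAtMost n ∧ P.HasApproxRatio (2 - (2 : ℝ) ^ (-(k : ℤ) + 1)) := by
  refine ⟨coverExtensionProtocol n k hk,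
    fun E i hi M hM => (coverExtensionProtocol_received_support hk E i hi M hM).1, ?_⟩
  have : (2 : ℝ) - 2 ^ (-(k : ℤ) + 1) = 1 + slack (k - 1) := by
    obtain ⟨j, rfl⟩ := Nat.exists_eq_succ_of_ne_zero hk.ne'
    have : -((j.succ : ℕ) : ℤ) + 1 = -(j : ℤ) := by push_cast; ring
    rw [this, slack, zpow_neg, zpow_natCast, Nat.succ_sub_one, one_div, inv_pow]
    ring
  rw [this]
  exact coverExtensionProtocol_hasApproxRatio hk

end Protocol

/-! ### Counting -/

lemma card_boolList_length_le (L : ℕ) :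
    (List.finite_length_le Bool L).toFinset.card ≤ 3 ^ L := by
  have h := Finset.card_le_card_of_injOn (s := (List.finite_length_le Bool L).toFinset)
    (t := (Finset.univ : Finset (Fin L → Option Bool))) (fun l i => l[i.1]?)
    (by simp [Set.MapsTo]) (by
      intro l hl l' hl' h
      simp only [Set.Finite.coe_toFinset, Set.mem_ofPred_eq] at hl hl'
      refine List.ext_getElem? fun i => ?_
      by_cases hi : i < L
      · exact congrFun h ⟨i, hi⟩
      · rw [List.getElem?_eq_none (by omega), List.getElem?_eq_none (by omega)])
  simpa using h

/-- If every `s`-element subset of `E` is contained in one of a family of subsets of density at most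
`1 - 1 / q`, then the family is large. -/
lemma pow_le_card_mul_of_covering {E ι : Type*} [Fintype E] [Nonempty E] [DecidableEq E]
    (I : Finset ι) (U : ι → Finset E) {s p : ℕ}
    (h : ∀ F : Finset E, F.card ≤ s →
      ∃ i ∈ I, F ⊆ U i ∧ (p + 1) * (U i).card ≤ p * Fintype.card E) :
    (p + 1) ^ s ≤ I.card * p ^ s := by
  classical
  -- Count `s`-tuples, not subsets: each tuple lies in some `U i`, and a sparse `U i` contains at
  -- most a fraction `(p / (p + 1)) ^ s` of them.
  have hsub : (Finset.univ : Finset (Fin s → E)) ⊆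
      (I.filter fun i => (p + 1) * (U i).card ≤ p * Fintype.card E).biUnion
        fun i => Fintype.piFinset fun _ => U i := by
    intro f _
    obtain ⟨i, hi, hF, hU⟩ := h (Finset.univ.image f) (Finset.card_image_le.trans (by simp))
    simp only [Finset.mem_biUnion, Finset.mem_filter, Fintype.mem_piFinset]
    exact ⟨i, ⟨hi, hU⟩, fun a => hF (Finset.mem_image_of_mem _ (Finset.mem_univ _))⟩
  have hcard := (Finset.card_le_card hsub).trans Finset.card_biUnion_le
  simp only [Finset.card_univ, Fintype.card_fun, Fintype.card_fin, Fintype.card_piFinset,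
    Finset.prod_const] at hcard
  refine Nat.le_of_mul_le_mul_right ?_ (pow_pos (Fintype.card_pos (α := E)) s)
  calc (p + 1) ^ s * Fintype.card E ^ s
      ≤ (p + 1) ^ s * ∑ i ∈ I.filter fun i => (p + 1) * (U i).card ≤ p * Fintype.card E,
          (U i).card ^ s := Nat.mul_le_mul_left _ hcard
    _ = ∑ i ∈ I.filter fun i => (p + 1) * (U i).card ≤ p * Fintype.card E,
          ((p + 1) * (U i).card) ^ s := by simp only [Finset.mul_sum, mul_pow]
    _ ≤ ∑ i ∈ I.filter fun i => (p + 1) * (U i).card ≤ p * Fintype.card E,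
          (p * Fintype.card E) ^ s :=
        Finset.sum_le_sum fun i hi => Nat.pow_le_pow_left (Finset.mem_filter.1 hi).2 s
    _ ≤ I.card * p ^ s * Fintype.card E ^ s := by
        rw [Finset.sum_const, smul_eq_mul, mul_pow, mul_assoc]
        exact Nat.mul_le_mul_right _ (Finset.card_filter_le _ _)

lemma two_mul_pow_succ_le (p : ℕ) : 2 * p ^ (p + 1) ≤ (p + 1) ^ (p + 1) := by
  -- Bernoulli's inequality, used at `k = p`.
  have h : ∀ k, p ^ (k + 1) + (k + 1) * p ^ k ≤ (p + 1) ^ (k + 1) := by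
    intro k
    induction k with
    | zero => simp
    | succ k ih =>
      have := Nat.mul_le_mul_right (p + 1) ih
      rw [pow_succ (p + 1) (k + 1)]
      refine le_trans ?_ this
      have e : p ^ (k + 1) = p ^ k * p := pow_succ p k
      rw [pow_succ p (k + 1), e]
      nlinarith [Nat.zero_le (p ^ k)]
  have := h p
  rw [pow_succ p p] at this ⊢
  nlinarith [Nat.zero_le (p ^ p)]

lemma le_two_mul_of_covering {E : Type*} [Fintype E] [Nonempty E] [DecidableEq E]
    (U : List Bool → Finset E) {p r L : ℕ} (hp : 0 < p)
    (h : ∀ F : Finset E, F.card ≤ (p + 1) * r →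
      ∃ M : List Bool, M.length ≤ L ∧ F ⊆ U M ∧ (p + 1) * (U M).card ≤ p * Fintype.card E) :
    r ≤ 2 * L := by
  have h1 := pow_le_card_mul_of_covering (List.finite_length_le Bool L).toFinset U
    (s := (p + 1) * r) (p := p) (by simpa using h)
  have h2 : 2 ^ r * p ^ ((p + 1) * r) ≤ (p + 1) ^ ((p + 1) * r) := by
    rw [pow_mul, pow_mul, ← mul_pow]
    exact Nat.pow_le_pow_left (two_mul_pow_succ_le p) r
  have h3 : 2 ^ r ≤ 3 ^ L := Nat.le_of_mul_le_mul_right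
    (h2.trans (h1.trans (Nat.mul_le_mul_right _ (card_boolList_length_le L)))) (by positivity)
  have h4 : 2 ^ r ≤ 2 ^ (2 * L) := by
    rw [pow_mul]
    exact h3.trans (Nat.pow_le_pow_left (by norm_num) L)
  exact (Nat.pow_le_pow_iff_right (by norm_num)).1 h4

/-! ### The hard instances -/

section PairGraph

variable {ι V : Type*}

/-- The graph with the edges `{a i, b i}`, for `i ∈ F`. -/
def pairGraph (F : Set ι) (a b : ι → V) : SimpleGraph V :=
  SimpleGraph.fromRel fun u v => ∃ i ∈ F, u = a i ∧ v = b i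

lemma pairGraph_isVertexCover_iff {F : Set ι} {a b : ι → V} (hab : ∀ i, a i ≠ b i) {S : Set V} :
    (pairGraph F a b).IsVertexCover S ↔ ∀ i ∈ F, a i ∈ S ∨ b i ∈ S := by
  constructor
  · intro h i hi
    exact h ((SimpleGraph.fromRel_adj _ _ _).2 ⟨hab i, Or.inl ⟨i, hi, rfl, rfl⟩⟩)
  · intro h u v huv
    rcases ((SimpleGraph.fromRel_adj _ _ _).1 huv).2 with ⟨i, hi, rfl, rfl⟩ | ⟨i, hi, rfl, rfl⟩
    exacts [h i hi, (h i hi).symm]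

end PairGraph

section HardInstance

/-- The vertices of `m` directed cubes of dimension `t + 1`: two copies `0` and `1` of every
point of the cube, and a pendant vertex `2`. -/
abbrev CubeVertex (m t : ℕ) : Type := Fin m × (Fin (t + 1) → Bool) × Fin 3

/-- The edges of `m` directed cubes of dimension `t + 1`: a direction, a cube, and the remaining
coordinates. -/
abbrev CubeEdge (m t : ℕ) : Type := Fin (t + 1) × Fin m × (Fin t → Bool)

variable {m t : ℕ} {V : Type*}

/-- The lower end of an edge. -/
def CubeEdge.lower (e : CubeEdge m t) : CubeVertex m t :=
  (e.2.1, Fin.insertNth (α := fun _ => Bool) e.1 false e.2.2, 0)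

/-- The upper end of an edge. -/
def CubeEdge.upper (e : CubeEdge m t) : CubeVertex m t :=
  (e.2.1, Fin.insertNth (α := fun _ => Bool) e.1 true e.2.2, 1)

/-- The pendant vertex at a point. -/
def pendant (p : Fin m × (Fin (t + 1) → Bool)) : CubeVertex m t := (p.1, p.2, 2)

/-- The vertex to which the pendant vertex of a point is attached for direction `j`. -/
def center (j : Fin (t + 1)) (p : Fin m × (Fin (t + 1) → Bool)) : CubeVertex m t :=
  (p.1, p.2, if p.2 j then 0 else 1)

variable (φ : CubeVertex m t ↪ V)

/-- The graph of the first party. -/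
def firstGraph (F : Finset (CubeEdge m t)) : SimpleGraph V :=
  pairGraph (F : Set (CubeEdge m t)) (fun e => φ e.lower) fun e => φ e.upper

/-- The graph of the second party: a perfect matching from the pendant vertices to the vertices not
matched by the edges of direction `j`. -/
def secondGraph (j : Fin (t + 1)) : SimpleGraph V :=
  pairGraph Set.univ (fun p => φ (pendant p)) fun p => φ (center j p)

/-- The edges of direction `j`. -/
def inDirection (F : Finset (CubeEdge m t)) (j : Fin (t + 1)) : Finset (CubeEdge m t) :=
  F.filter fun e => e.1 = j

lemma sum_card_inDirection (F : Finset (CubeEdge m t)) :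
    ∑ j, (inDirection F j).card = F.card :=
  (Finset.card_eq_sum_card_fiberwise fun _ _ => Finset.mem_coe.2 (Finset.mem_univ _)).symm

variable {φ}

lemma firstGraph_isVertexCover_iff {F : Finset (CubeEdge m t)} {S : Finset V} :
    (firstGraph φ F).IsVertexCover S ↔ ∀ e ∈ F, φ e.lower ∈ S ∨ φ e.upper ∈ S :=
  pairGraph_isVertexCover_iff fun e => φ.injective.ne (by simp [CubeEdge.lower, CubeEdge.upper])

lemma secondGraph_isVertexCover_iff {j : Fin (t + 1)} {S : Finset V} :
    (secondGraph φ j).IsVertexCover S ↔ ∀ p, φ (pendant p) ∈ S ∨ φ (center j p) ∈ S := by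
  rw [secondGraph, pairGraph_isVertexCover_iff]
  · simp
  · refine fun p => φ.injective.ne ?_
    rw [pendant, center]
    split_ifs <;> simp

/-- The member of the matching formed by the pendant edges and the edges of direction `j` that
contains a vertex. -/
def matchedWith (j : Fin (t + 1)) (v : CubeVertex m t) :
    (Fin m × (Fin (t + 1) → Bool)) ⊕ CubeEdge m t :=
  if v.2.2 = 2 ∨ (v.2.2 = 0 ↔ v.2.1 j = true) then Sum.inl (v.1, v.2.1)
  else Sum.inr (j, v.1, j.removeNth v.2.1)

/-- The pendant edges and the direction-`j` edges of `F` are pairwise disjoint, so each needs its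
own cover vertex. -/
lemma card_le_of_isVertexCover {F : Finset (CubeEdge m t)} {j : Fin (t + 1)} {S : Finset V}
    (h1 : (firstGraph φ F).IsVertexCover S) (h2 : (secondGraph φ j).IsVertexCover S) :
    m * 2 ^ (t + 1) + (inDirection F j).card ≤ S.card := by
  classical
  rw [firstGraph_isVertexCover_iff] at h1
  rw [secondGraph_isVertexCover_iff] at h2
  have hsub : (Finset.univ : Finset (Fin m × (Fin (t + 1) → Bool))).disjSum (inDirection F j) ⊆
      (S.preimage φ φ.injective.injOn).image (matchedWith j) := by
    rintro (p | e) h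
    · rcases h2 p with h | h
      · exact Finset.mem_image.2 ⟨_, Finset.mem_preimage.2 h, by simp [matchedWith, pendant]⟩
      · refine Finset.mem_image.2 ⟨_, Finset.mem_preimage.2 h, ?_⟩
        by_cases hp : p.2 j <;> simp [matchedWith, center, hp]
    · obtain ⟨he, rfl⟩ := Finset.mem_filter.1 (Finset.inr_mem_disjSum.1 h)
      rcases h1 e he with h | h
      · exact Finset.mem_image.2 ⟨_, Finset.mem_preimage.2 h,
          by simp [matchedWith, CubeEdge.lower]⟩
      · exact Finset.mem_image.2 ⟨_, Finset.mem_preimage.2 h,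
          by simp [matchedWith, CubeEdge.upper]⟩
  have hcard := (Finset.card_le_card hsub).trans
    (Finset.card_image_le.trans (Finset.card_le_card_of_injOn φ (fun v hv => by simpa using hv)
      φ.injective.injOn))
  simpa [Finset.card_disjSum] using hcard

/-- The centers already cover every edge of another direction: its ends share coordinate `j`, so the
lower end is a center if that bit is `true` and the upper end otherwise. -/
lemma mvcSize_hardInstance_le (F : Finset (CubeEdge m t)) (j : Fin (t + 1)) :
    mvcSize (firstGraph φ F ⊔ secondGraph φ j) ≤
      m * 2 ^ (t + 1) + (inDirection F j).card := by
  classical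
  have hcover : (firstGraph φ F ⊔ secondGraph φ j).IsVertexCover
      (Finset.univ.image (fun p => φ (center j p)) ∪
        (inDirection F j).image (fun e => φ e.lower) : Finset V) := by
    have h1 : (firstGraph φ F).IsVertexCover (Finset.univ.image (fun p => φ (center j p)) ∪
        (inDirection F j).image (fun e => φ e.lower) : Finset V) := by
      rw [firstGraph_isVertexCover_iff]
      intro e he
      by_cases hj : e.1 = j
      · exact Or.inl (Finset.mem_union_right _
          (Finset.mem_image_of_mem _ (Finset.mem_filter.2 ⟨he, hj⟩)))
      · obtain ⟨i, hi⟩ := Fin.exists_succAbove_eq (Ne.symm hj)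
        have hl : (Fin.insertNth (α := fun _ => Bool) e.1 false e.2.2) j = e.2.2 i := by
          rw [← hi, Fin.insertNth_apply_succAbove]
        have hu : (Fin.insertNth (α := fun _ => Bool) e.1 true e.2.2) j = e.2.2 i := by
          rw [← hi, Fin.insertNth_apply_succAbove]
        by_cases hz : e.2.2 i = true
        · refine Or.inl (Finset.mem_union_left _ (Finset.mem_image.2
            ⟨(e.2.1, Fin.insertNth (α := fun _ => Bool) e.1 false e.2.2), Finset.mem_univ _, ?_⟩))
          simp only [center, hl, hz, CubeEdge.lower, if_true]
        · refine Or.inr (Finset.mem_union_left _ (Finset.mem_image.2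
            ⟨(e.2.1, Fin.insertNth (α := fun _ => Bool) e.1 true e.2.2), Finset.mem_univ _, ?_⟩))
          simp only [center, hu, hz, CubeEdge.upper, Bool.false_eq_true, if_false]
    have h2 : (secondGraph φ j).IsVertexCover (Finset.univ.image (fun p => φ (center j p)) ∪
        (inDirection F j).image (fun e => φ e.lower) : Finset V) := by
      rw [secondGraph_isVertexCover_iff]
      exact fun p => Or.inr (Finset.mem_union_left _
        (Finset.mem_image_of_mem (fun p => φ (center j p)) (Finset.mem_univ p)))
    intro u v huv
    exact huv.elim (fun h => h1 h) fun h => h2 h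
  refine (mvcSize_le_card hcover).trans ((Finset.card_union_le _ _).trans
    (add_le_add (Finset.card_image_le.trans ?_) Finset.card_image_le))
  simp

end HardInstance

/-! ### The lower bound -/

namespace OneWayProtocol

variable {V : Type*}

/-- The edges that the first party may hold when it sends the message `M`. -/
def possibleEdges {m t : ℕ} (P : OneWayProtocol V 2) (φ : CubeVertex m t ↪ V) (M : List Bool) :
    Finset (CubeEdge m t) := by
  classical
  exact Finset.univ.filter fun e =>
    ∃ F, M ∈ (P.send 0 (firstGraph φ F) []).support ∧ e ∈ F

lemma subset_possibleEdges {m t : ℕ} {P : OneWayProtocol V 2} {φ : CubeVertex m t ↪ V}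
    {M : List Bool} {F : Finset (CubeEdge m t)}
    (h : M ∈ (P.send 0 (firstGraph φ F) []).support) : F ⊆ P.possibleEdges φ M := by
  intro e he
  simp only [possibleEdges, Finset.mem_filter, Finset.mem_univ, true_and]
  exact ⟨F, h, he⟩

lemma received_one (P : OneWayProtocol V 2) (A B : SimpleGraph V) (h : 1 < 2) :
    P.received ![A, B] 1 h = P.send 0 A [] := by
  simp [received]

lemma outputDist_two (P : OneWayProtocol V 2) (A B : SimpleGraph V) :
    P.outputDist ![A, B] = (P.send 0 A []).bind fun M => P.output B M := by
  simp [outputDist, received]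

lemma iSup_two (A B : SimpleGraph V) : (⨆ i, ![A, B] i) = A ⊔ B := by
  refine le_antisymm (iSup_le fun i => ?_) (sup_le (le_iSup ![A, B] 0) (le_iSup ![A, B] 1))
  fin_cases i
  exacts [le_sup_left, le_sup_right]

variable {m t : ℕ} {P : OneWayProtocol V 2}

/-- An output possible after `M` is possible for every `F` that may send `M`, so it must cover the
union of all these `F`. -/
lemma card_output_ge (hP : P.IsValid) (φ : CubeVertex m t ↪ V) {F₀ : Finset (CubeEdge m t)}
    {j : Fin (t + 1)} {M : List Bool}
    (hM : M ∈ (P.send 0 (firstGraph φ F₀) []).support) {S : Finset V}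
    (hS : S ∈ (P.output (secondGraph φ j) M).support) :
    m * 2 ^ (t + 1) + (inDirection (P.possibleEdges φ M) j).card ≤ S.card := by
  have hcover : ∀ F, M ∈ (P.send 0 (firstGraph φ F) []).support →
      (firstGraph φ F ⊔ secondGraph φ j).IsVertexCover S := by
    intro F hF
    rw [← iSup_two]
    refine hP _ S ?_
    rw [outputDist_two, PMF.mem_support_bind_iff]
    exact ⟨M, hF, hS⟩
  refine card_le_of_isVertexCover (φ := φ) ?_ ((hcover F₀ hM).mono le_sup_right)
  rw [firstGraph_isVertexCover_iff]
  intro e he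
  simp only [possibleEdges, Finset.mem_filter, Finset.mem_univ, true_and] at he
  obtain ⟨F, hF, heF⟩ := he
  exact firstGraph_isVertexCover_iff.1 ((hcover F hF).mono le_sup_left) e heF

lemma exists_message_le_sum_expectedSize [Fintype V] (hP : P.IsValid)
    (φ : CubeVertex m t ↪ V) (F : Finset (CubeEdge m t)) :
    ∃ M ∈ (P.send 0 (firstGraph φ F) []).support,
      (((t + 1) * (m * 2 ^ (t + 1)) + (P.possibleEdges φ M).card : ℕ) : ℝ) ≤
        ∑ j, P.expectedSize ![firstGraph φ F, secondGraph φ j] := by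
  -- The possible message leaving the fewest compatible edges bounds the cost of all the others from
  -- below, which removes the randomness.
  obtain ⟨M, hM, hmin⟩ := (measure fun M => (P.possibleEdges φ M).card).wf.has_min
    (P.send 0 (firstGraph φ F) []).support (P.send 0 (firstGraph φ F) []).support_nonempty
  refine ⟨M, hM, ?_⟩
  rw [← ENNReal.ofReal_le_ofReal_iff (Finset.sum_nonneg fun _ _ => P.expectedSize_nonneg _),
    ENNReal.ofReal_natCast, ENNReal.ofReal_sum_of_nonneg fun _ _ => P.expectedSize_nonneg _]
  simp only [ofReal_expectedSize, outputDist_two, PMF.expect_bind]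
  rw [← PMF.expect_sum]
  refine PMF.le_expect fun M' hM' => ?_
  calc (((t + 1) * (m * 2 ^ (t + 1)) + (P.possibleEdges φ M).card : ℕ) : ℝ≥0∞)
      ≤ (((t + 1) * (m * 2 ^ (t + 1)) + (P.possibleEdges φ M').card : ℕ) : ℝ≥0∞) :=
        Nat.cast_le.2 (Nat.add_le_add_left (not_lt.1 (hmin M' hM')) _)
    _ = ∑ j, ((m * 2 ^ (t + 1) + (inDirection (P.possibleEdges φ M') j).card : ℕ) : ℝ≥0∞) := by
        rw [← Nat.cast_sum, Finset.sum_add_distrib, sum_card_inDirection]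
        simp
    _ ≤ _ := Finset.sum_le_sum fun j _ => PMF.le_expect fun S hS =>
        Nat.cast_le.2 (card_output_ge hP φ hM' hS)

lemma exists_message_card_possibleEdges_le [Fintype V] {r : ℝ} (hr : 0 ≤ r)
    (hPr : P.HasApproxRatio r) (φ : CubeVertex m t ↪ V) (F : Finset (CubeEdge m t)) :
    ∃ M ∈ (P.send 0 (firstGraph φ F) []).support,
      (2 * Fintype.card (CubeEdge m t) + (P.possibleEdges φ M).card : ℝ) ≤
        r * (2 * Fintype.card (CubeEdge m t) + F.card) := by
  obtain ⟨M, hM, hle⟩ := exists_message_le_sum_expectedSize hPr.1 φ F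
  -- Summed over directions, the pendants cost twice the number of cube edges; full uncertainty
  -- would add that number once more, whence `3/2`.
  have hcard : (t + 1) * (m * 2 ^ (t + 1)) = 2 * Fintype.card (CubeEdge m t) := by
    simp [pow_succ]
    ring
  have hsum : ∑ j, P.expectedSize ![firstGraph φ F, secondGraph φ j] ≤
      r * (((t + 1) * (m * 2 ^ (t + 1)) + F.card : ℕ) : ℝ) := by
    calc ∑ j, P.expectedSize ![firstGraph φ F, secondGraph φ j]
        ≤ ∑ j, r * ((m * 2 ^ (t + 1) + (inDirection F j).card : ℕ) : ℝ) := by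
          refine Finset.sum_le_sum fun j _ => (hPr.2 _).trans ?_
          rw [iSup_two]
          exact mul_le_mul_of_nonneg_left (Nat.cast_le.2 (mvcSize_hardInstance_le F j)) hr
      _ = _ := by
          rw [← Finset.mul_sum, ← Nat.cast_sum, Finset.sum_add_distrib, sum_card_inDirection]
          simp
  rw [hcard] at hle hsum
  refine ⟨M, hM, ?_⟩
  have := hle.trans hsum
  push_cast at this
  exact this

end OneWayProtocol

theorem not_hasApproxRatio_of_linear_communication {ε : ℝ} (hε : 0 < ε) (C : ℕ) :
    ∃ n₀ : ℕ, ∀ n : ℕ, n₀ ≤ n → ∀ P : OneWayProtocol (Fin n) 2,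
      P.MessagesAtMost (C * n) → ¬ P.HasApproxRatio (3 / 2 - ε) := by
  -- The cap keeps the ratio `3 / 2 - δ` nonnegative.
  set δ := min ε 1 with hδ
  have hδ0 : 0 < δ := lt_min hε one_pos
  obtain ⟨p, hp⟩ := exists_nat_gt (2 / δ)
  have hp0 : 0 < p := by
    have : (0 : ℝ) < p := (div_pos two_pos hδ0).trans hp
    exact_mod_cast this
  -- With `N` cube edges, sets of `N / (p + 1) = (p + 1) * r` edges are used, where `r = (24 * C +
  -- 1) * (m * 2 ^ t)`. As `n ≤ 12 * (m * 2 ^ t)`, this `r` exceeds `2 * (C * n)`, contradicting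
  -- `le_two_mul_of_covering`.
  obtain ⟨t, ht⟩ : ∃ t, t + 1 = (p + 1) * (p + 1) * (24 * C + 1) :=
    ⟨(p + 1) * (p + 1) * (24 * C + 1) - 1, Nat.sub_add_cancel (Nat.succ_le_of_lt (by positivity))⟩
  -- One cube with its copies and pendants has `3 * 2 ^ (t + 1)` vertices.
  refine ⟨6 * 2 ^ t, fun n hn P hB hP => ?_⟩
  obtain ⟨m, hm0, hmn, hnm⟩ : ∃ m, 0 < m ∧ 6 * 2 ^ t * m ≤ n ∧ n ≤ 12 * (m * 2 ^ t) := by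
    have hpos : 0 < 6 * 2 ^ t := by positivity
    have h1 : 1 ≤ n / (6 * 2 ^ t) := (Nat.one_le_div_iff hpos).2 hn
    refine ⟨n / (6 * 2 ^ t), h1, Nat.mul_div_le _ _, ?_⟩
    have h2 := Nat.lt_mul_div_succ n hpos
    nlinarith
  obtain ⟨φ⟩ : Nonempty (CubeVertex m t ↪ Fin n) := by
    refine Function.Embedding.nonempty_of_card_le ?_
    simp [pow_succ]
    linarith
  have : Nonempty (CubeEdge m t) := ⟨(0, ⟨0, hm0⟩, fun _ => false)⟩
  have hcard : Fintype.card (CubeEdge m t) =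
      (p + 1) * ((p + 1) * ((24 * C + 1) * (m * 2 ^ t))) := by
    simp only [Fintype.card_prod, Fintype.card_fin, Fintype.card_fun, Fintype.card_bool, ht]
    ring
  have hP' : P.HasApproxRatio (3 / 2 - δ) :=
    ⟨hP.1, fun E => (hP.2 E).trans (mul_le_mul_of_nonneg_right
      (by linarith [min_le_left ε 1]) (Nat.cast_nonneg _))⟩
  have hlarge : (24 * C + 1) * (m * 2 ^ t) ≤ 2 * (C * n) := by
    refine le_two_mul_of_covering (P.possibleEdges φ) hp0 fun F hF => ?_
    obtain ⟨M, hM, hle⟩ := OneWayProtocol.exists_message_card_possibleEdges_le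
      (by linarith [min_le_right ε 1]) hP' φ F
    refine ⟨M, ?_, OneWayProtocol.subset_possibleEdges hM, ?_⟩
    · refine hB ![firstGraph φ F, ⊥] 1 one_lt_two M ?_
      rwa [OneWayProtocol.received_one]
    · set N := Fintype.card (CubeEdge m t) with hN
      have hF' : ((p : ℝ) + 1) * F.card ≤ N := by
        rw [hcard]
        exact_mod_cast Nat.mul_le_mul_left _ hF
      have hδp : 2 ≤ δ * p := by
        rw [div_lt_iff₀ hδ0] at hp
        linarith
      have hNpos : (0 : ℝ) ≤ N := Nat.cast_nonneg _
      have hFpos : (0 : ℝ) ≤ F.card := Nat.cast_nonneg _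
      have hgoal : ((p : ℝ) + 1) * (P.possibleEdges φ M).card ≤ p * N := by
        have h1 := mul_le_mul_of_nonneg_left hle (by positivity : (0 : ℝ) ≤ p + 1)
        have h2 : (3 / 2 - δ) * (((p : ℝ) + 1) * F.card) ≤ (3 / 2) * N := by
          have : 0 ≤ δ * (((p : ℝ) + 1) * F.card) := by positivity
          linarith
        have h3 : 2 * N ≤ (δ * p) * N := mul_le_mul_of_nonneg_right hδp hNpos
        have h4 : 0 ≤ δ * N := by positivity
        nlinarith
      exact_mod_cast hgoal
  have h5 : C * n ≤ C * (12 * (m * 2 ^ t)) := Nat.mul_le_mul_left _ hnm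
  have h6 : 0 < m * 2 ^ t := by positivity
  nlinarith

end

theorem theorem1 :
    (∀ k : ℕ, 2 ≤ k → ∀ ε : ℝ, 0 < ε →
      ∃ C : ℕ, ∀ n : ℕ, ∃ P : OneWayProtocol (Fin n) k,
        P.MessagesAtMost (C * n) ∧ P.HasApproxRatio (2 - (2 : ℝ) ^ (-(k : ℤ) + 1) + ε)) ∧
    (∀ ε : ℝ, 0 < ε → ∀ C : ℕ,
      ∃ n₀ : ℕ, ∀ n : ℕ, n₀ ≤ n → ∀ P : OneWayProtocol (Fin n) 2,
        P.MessagesAtMost (C * n) → ¬ P.HasApproxRatio (3 / 2 - ε)) := by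
  -- A message is one characteristic vector of `n` bits, so `C = 1` works, even without the loss of
  -- `ε`.
  refine ⟨fun k hk ε hε => ⟨1, fun n => ?_⟩,
    fun ε hε C => not_hasApproxRatio_of_linear_communication hε C⟩
  obtain ⟨P, hB, hV, hP⟩ := exists_protocol_ratio n (by omega : 0 < k)
  refine ⟨P, by rwa [one_mul], hV, fun E => (hP E).trans ?_⟩
  exact mul_le_mul_of_nonneg_right (by linarith) (Nat.cast_nonneg _)
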